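/- Let $n\ge 0$ and let $\pi$ be a partial involution of size $n$, i.e. a symmetric $n\times n$ matrix with entries in $\{0,1\}$ having at most one entry equal to $1$ in each row and in each column. Let $\mathbb B_n(\mathbb C)$ be the group of invertible upper-triangular complex $n\times n$ matrices and let $\mathcal C_\pi=\{B^t\pi B : B\in\mathbb B_n(\mathbb C)\}$ be the congruence $B$-orbit of $\pi$ (a set of complex symmetric matrices). For $1\le i,j\le n$ let $r_{ij}$ be the rank of the upper-left $i\times j$ submatrix of $\pi$, put $r_{0k}=0$ for $0\le k<n$, and let $$\mathfrak D(\pi)=\#\{(i,j) : 1\le i\le j\le n,\ r_{ij}=r_{i-1,j-1}\}.$$ Let $\overline{\mathcal C_\pi}$ be the Zariski closure of $\mathcal C_\pi$ in the affine space $\mathbb C^{n^2}$ of complex $n\times n$ matrices. Then $$\dim\overline{\mathcal C_\pi}=\frac{n^2+n}{2}-\mathfrak D(\pi).$$ -/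

import Mathlib

namespace BorelCongruence

/-- A partial involution of size `n`: a symmetric `(0,1)`-matrix, viewed as a complex matrix,
with at most one entry `1` in each row and in each column. -/
structure IsPartialInvolution {n : ℕ} (P : Matrix (Fin n) (Fin n) ℂ) : Prop where
  zero_or_one : ∀ i j, P i j = 0 ∨ P i j = 1
  row : ∀ i j j', P i j = 1 → P i j' = 1 → j = j'
  col : ∀ i i' j, P i j = 1 → P i' j = 1 → i = i'
  symm : P.IsSymm

/-- The Borel group: invertible upper-triangular complex matrices, as a set. -/
def borel (n : ℕ) : Set (Matrix (Fin n) (Fin n) ℂ) :=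
  {B | IsUnit B ∧ ∀ i j : Fin n, j < i → B i j = 0}

/-- The congruence B-orbit `{Bᵗ S B : B ∈ borel n}` of a matrix `S`. -/
def congruenceOrbit {n : ℕ} (S : Matrix (Fin n) (Fin n) ℂ) : Set (Matrix (Fin n) (Fin n) ℂ) :=
  {A | ∃ B ∈ borel n, A = B.transpose * S * B}

/-- `rankControl X k l` is the rank of the upper-left `k × l` submatrix of `X`, made of the first
`k` rows and the first `l` columns. It is `0` for `k = 0` or `l = 0`. -/
noncomputable def rankControl {n m : ℕ} (X : Matrix (Fin n) (Fin m) ℂ) (k l : ℕ) : ℕ :=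
  (X.submatrix (fun i : {i : Fin n // (i : ℕ) < k} => (i : Fin n))
    (fun j : {j : Fin m // (j : ℕ) < l} => (j : Fin m))).rank

/-- The added row of the rank-control matrix consists of zeros. -/
theorem rankControl_zero_left {n m : ℕ} (X : Matrix (Fin n) (Fin m) ℂ) (l : ℕ) :
    rankControl X 0 l = 0 := by
  have h := Matrix.rank_le_card_height
    (X.submatrix (fun i : {i : Fin n // (i : ℕ) < 0} => (i : Fin n))
      (fun j : {j : Fin m // (j : ℕ) < l} => (j : Fin m)))
  simpa [rankControl] using h

/-- The number of pairs `1 ≤ i ≤ j ≤ n` with `r_{ij} = r_{i-1,j-1}`, where `(r_{ij})` is the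
rank-control matrix extended by a zero row. -/
noncomputable def diagonalEqualities {n : ℕ} (P : Matrix (Fin n) (Fin n) ℂ) : ℕ :=
  ((Finset.Icc 1 n ×ˢ Finset.Icc 1 n).filter
    (fun p : ℕ × ℕ => p.1 ≤ p.2 ∧
      rankControl P p.1 p.2 = rankControl P (p.1 - 1) (p.2 - 1))).card

/-- The ideal of all complex polynomials in the `n²` matrix entries that vanish on `V`. -/
noncomputable def idealOf {n : ℕ} (V : Set (Matrix (Fin n) (Fin n) ℂ)) :
    Ideal (MvPolynomial (Fin n × Fin n) ℂ) :=
  MvPolynomial.vanishingIdeal ℂ ((fun A p => A p.1 p.2) '' V)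

/-- The Zariski closure of a set of matrices in the affine space of all `n × n` matrices:
the set of common zeros of all polynomials that vanish on the set. -/
def zariskiClosure {n : ℕ} (V : Set (Matrix (Fin n) (Fin n) ℂ)) :
    Set (Matrix (Fin n) (Fin n) ℂ) :=
  {A | ∀ f ∈ idealOf V, MvPolynomial.eval (fun p => A p.1 p.2) f = 0}

/-- The dimension of a Zariski closed set of matrices: the Krull dimension of its coordinate
ring. -/
noncomputable def varietyDim {n : ℕ} (V : Set (Matrix (Fin n) (Fin n) ℂ)) : WithBot ℕ∞ :=
  ringKrullDim (MvPolynomial (Fin n × Fin n) ℂ ⧸ idealOf V)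

end BorelCongruence

namespace BorelCongruence

/-! Invertible triangular matrices are dense among all triangular ones, so the coordinate ring of
the closure is generated by the entries of `BᵗPB` for a generic upper-triangular `B`. Its dimension
is its transcendence degree, shown to be the number of jumps, the complement of the counted
equalities in the upper triangle.

Upper bound: at a non-jump `(i, j)` the last row and last column of the leading block of `BᵗPB`
depend on the earlier ones, so that entry is rational in the others
(`congruenceTransform_mem_adjoin`). Lower bound: for a special `B` with one variable per jump, every
variable is algebraic over the jump entries of `BᵗPB`, so these are algebraically independent
(`isAlgebraic_jumpVariable`). -/

/-! ### Krull dimension and transcendence degree -/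

theorem ringKrullDim_eq_of_isIntegral (R S : Type*) [CommRing R] [CommRing S] [Algebra R S]
    [FaithfulSMul R S] [Algebra.IsIntegral R S] : ringKrullDim S = ringKrullDim R := by
  apply le_antisymm
  -- Incomparability makes contraction of primes strictly monotone; for the other inequality, lying
  -- over and going up lift chains.
  · refine Order.krullDim_le_of_strictMono (PrimeSpectrum.comap (algebraMap R S)) ?_
    intro I J hIJ
    obtain ⟨hle, x, hxJ, hxI⟩ := SetLike.lt_iff_le_and_exists.mp
      (show I.asIdeal < J.asIdeal from hIJ)
    exact Ideal.comap_lt_comap_of_integral_mem_sdiff hle ⟨hxJ, hxI⟩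
      (Algebra.IsIntegral.isIntegral x)
  · refine iSup_le fun l => ?_
    obtain ⟨⟨Q, hQ, hQl⟩⟩ := Ideal.nonempty_primesOver (S := S) l.head.asIdeal
    obtain ⟨L, hL, -⟩ := Ideal.exists_ltSeries_of_hasGoingUp l Q
    rw [← hL]
    exact le_iSup (fun p : LTSeries (PrimeSpectrum S) => (p.length : WithBot ℕ∞)) L

/-- By Noether normalization, both invariants equal the number of variables of a polynomial ring
over which `A` is integral. -/
theorem exists_ringKrullDim_eq_and_trdeg_eq (k : Type*) [Field k] (A : Type*) [CommRing A]
    [IsDomain A] [Algebra k A] [Algebra.FiniteType k A] :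
    ∃ s : ℕ, ringKrullDim A = s ∧ Algebra.trdeg k A = s := by
  obtain ⟨s, g, hinj, hint⟩ := exists_integral_inj_algHom_of_fg k A
  refine ⟨s, ?_, ?_⟩
  · algebraize [g.toRingHom]
    have : FaithfulSMul (MvPolynomial (Fin s) k) A :=
      (faithfulSMul_iff_algebraMap_injective _ _).mpr hinj
    have : Algebra.IsIntegral (MvPolynomial (Fin s) k) A := ⟨hint⟩
    rw [ringKrullDim_eq_of_isIntegral (MvPolynomial (Fin s) k) A]
    simp
  · algebraize [g.toRingHom]
    have : FaithfulSMul (MvPolynomial (Fin s) k) A :=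
      (faithfulSMul_iff_algebraMap_injective _ _).mpr hinj
    have : Algebra.IsIntegral (MvPolynomial (Fin s) k) A := ⟨hint⟩
    have : IsScalarTower k (MvPolynomial (Fin s) k) A :=
      IsScalarTower.of_algebraMap_eq fun x => (g.commutes x).symm
    have h := lift_trdeg_add_eq k (MvPolynomial (Fin s) k) A
    rw [trdeg_eq_zero (R := MvPolynomial (Fin s) k) (A := A)] at h
    have h' := congrArg Cardinal.toNat h
    simpa using h.symm

/-! ### Rank control and counting jumps -/

theorem rank_eq_card_nonzero_rows {α β : Type*} [Fintype α] [Fintype β] [DecidableEq α]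
    (A : Matrix α β ℂ) (h01 : ∀ i j, A i j = 0 ∨ A i j = 1)
    (hcol : ∀ i i' j, A i j = 1 → A i' j = 1 → i = i') :
    A.rank = Nat.card {i // ∃ j, A i j = 1} := by
  classical
  have hcol_eq : ∀ i j, A i j = 1 → A.col j = Pi.single i 1 := by
    intro i j hij
    funext i'
    by_cases h : i' = i
    · subst h; simpa using hij
    · rw [Pi.single_eq_of_ne h]
      exact (h01 i' j).resolve_right fun h' => h (hcol _ _ _ h' hij)
  have hspan : Submodule.span ℂ (Set.range A.col) =
      Submodule.span ℂ (Set.range fun i : {i // ∃ j, A i j = 1} => (Pi.single i.1 1 : α → ℂ)) := by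
    apply le_antisymm
    · rw [Submodule.span_le]
      rintro _ ⟨j, rfl⟩
      by_cases h : ∃ i, A i j = 1
      · obtain ⟨i, hi⟩ := h
        rw [hcol_eq i j hi]
        exact Submodule.subset_span ⟨⟨i, j, hi⟩, rfl⟩
      · have : A.col j = 0 := by
          funext i
          exact (h01 i j).resolve_right fun h' => h ⟨i, h'⟩
        rw [this]
        exact Submodule.zero_mem _
    · rw [Submodule.span_le]
      rintro _ ⟨⟨i, j, hij⟩, rfl⟩
      exact Submodule.subset_span ⟨j, hcol_eq i j hij⟩
  rw [Matrix.rank_eq_finrank_span_cols, hspan, finrank_span_eq_card, Nat.card_eq_fintype_card]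
  have := (Pi.basisFun ℂ α).linearIndependent.comp
    (Subtype.val : {i // ∃ j, A i j = 1} → α) Subtype.val_injective
  convert this using 1
  funext i
  simp

open Classical in
theorem rankControl_eq_card {n : ℕ} {P : Matrix (Fin n) (Fin n) ℂ} (hP : IsPartialInvolution P)
    (k l : ℕ) : rankControl P k l =
      (Finset.univ.filter fun i : Fin n => (i : ℕ) < k ∧ ∃ j : Fin n, (j : ℕ) < l ∧ P i j = 1).card := by
  refine (rank_eq_card_nonzero_rows (P.submatrix _ _) (fun _ _ => hP.zero_or_one _ _)
    fun _ _ _ h h' => Subtype.ext (hP.col _ _ _ h h')).trans ?_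
  rw [← Fintype.card_subtype, ← Nat.card_eq_fintype_card]
  refine Nat.card_congr
    ⟨fun i => ⟨i.1.1, i.1.2, ?_⟩, fun i => ⟨⟨i.1, i.2.1⟩, ?_⟩, fun _ => rfl, fun _ => rfl⟩
  · obtain ⟨j, hj⟩ := i.2
    exact ⟨j.1, j.2, hj⟩
  · obtain ⟨j, hj, h⟩ := i.2.2
    exact ⟨⟨j, hj⟩, h⟩

/-- The positions `(i, j)` of the upper triangle at which the rank-control matrix jumps along the
diagonal: row `i` has a `1` in a column `≤ j`, or column `j` has a `1` in a row `< i`. -/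
def IsJump {n : ℕ} (P : Matrix (Fin n) (Fin n) ℂ) (p : Fin n × Fin n) : Prop :=
  p.1 ≤ p.2 ∧ ((∃ k ≤ p.2, P p.1 k = 1) ∨ ∃ k < p.1, P k p.2 = 1)

/-- These ranks count ones, so a diagonal step changes the rank exactly when a one lies in the added
hook. Indices here start at 0, hence the shift. -/
theorem rankControl_eq_iff {n : ℕ} {P : Matrix (Fin n) (Fin n) ℂ} (hP : IsPartialInvolution P)
    (i j : Fin n) : rankControl P (i + 1) (j + 1) = rankControl P i j ↔
      ¬((∃ k ≤ j, P i k = 1) ∨ ∃ k < i, P k j = 1) := by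
  classical
  rw [rankControl_eq_card hP, rankControl_eq_card hP]
  have hsub : (Finset.univ.filter fun p : Fin n =>
      (p : ℕ) < i ∧ ∃ q : Fin n, (q : ℕ) < j ∧ P p q = 1) ⊆
      Finset.univ.filter fun p : Fin n =>
        (p : ℕ) < i + 1 ∧ ∃ q : Fin n, (q : ℕ) < j + 1 ∧ P p q = 1 := by
    intro p hp
    simp only [Finset.mem_filter, Finset.mem_univ, true_and] at hp ⊢
    obtain ⟨h, q, hq, hpq⟩ := hp
    exact ⟨by omega, q, by omega, hpq⟩
  constructor
  · intro h
    have heq := Finset.eq_of_subset_of_card_le hsub h.le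
    have hmem : ∀ p q : Fin n, p ≤ i → q ≤ j → P p q = 1 → p < i ∧ q < j := by
      intro p q hp hq hpq
      have : p ∈ Finset.univ.filter fun p : Fin n =>
          (p : ℕ) < i + 1 ∧ ∃ q : Fin n, (q : ℕ) < j + 1 ∧ P p q = 1 := by
        simp only [Finset.mem_filter, Finset.mem_univ, true_and]
        exact ⟨by omega, q, by omega, hpq⟩
      rw [← heq] at this
      simp only [Finset.mem_filter, Finset.mem_univ, true_and] at this
      obtain ⟨h1, q', hq', h2⟩ := this
      rw [hP.row p q q' hpq h2]
      exact ⟨h1, hq'⟩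
    rintro (⟨k, hk, hk1⟩ | ⟨k, hk, hk1⟩)
    · exact (hmem i k le_rfl hk hk1).1.false
    · exact (hmem k j hk.le le_rfl hk1).2.false
  · intro h
    push Not at h
    refine congrArg Finset.card (subset_antisymm ?_ hsub)
    intro p hp
    simp only [Finset.mem_filter, Finset.mem_univ, true_and] at hp ⊢
    obtain ⟨hpi, q, hq, hpq⟩ := hp
    have hpi' : p ≠ i := by
      rintro rfl
      exact h.1 q (by omega) hpq
    have hpi'' : p < i := by omega
    have hqj : q ≠ j := by
      rintro rfl
      exact h.2 p hpi'' hpq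
    exact ⟨hpi'', q, by omega, hpq⟩

theorem card_isJump {n : ℕ} {P : Matrix (Fin n) (Fin n) ℂ} (hP : IsPartialInvolution P) :
    (Nat.card {p // IsJump P p} : ℚ) =
      ((n : ℚ) ^ 2 + (n : ℚ)) / 2 - (diagonalEqualities P : ℚ) := by
  classical
  have hD : diagonalEqualities P =
      (Finset.univ.filter fun p : Fin n × Fin n => p.1 ≤ p.2 ∧ ¬IsJump P p).card := by
    symm
    refine Finset.card_bij (fun p _ => ((p.1 : ℕ) + 1, (p.2 : ℕ) + 1)) ?_ ?_ ?_
    · rintro ⟨i, j⟩ hp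
      simp only [Finset.mem_filter, Finset.mem_univ, true_and, IsJump, not_and] at hp
      simp only [Finset.mem_filter, Finset.mem_product, Finset.mem_Icc, Nat.add_sub_cancel]
      refine ⟨by omega, by simpa using hp.1, (rankControl_eq_iff hP i j).mpr (hp.2 hp.1)⟩
    · rintro ⟨i, j⟩ _ ⟨i', j'⟩ _ h
      simp only [Prod.mk.injEq, add_left_inj] at h
      exact Prod.ext (Fin.ext h.1) (Fin.ext h.2)
    · rintro ⟨a, b⟩ h
      simp only [Finset.mem_filter, Finset.mem_product, Finset.mem_Icc] at h
      obtain ⟨⟨⟨ha, ha'⟩, hb, hb'⟩, hab, hr⟩ := h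
      refine ⟨(⟨a - 1, by omega⟩, ⟨b - 1, by omega⟩), ?_, ?_⟩
      · simp only [Finset.mem_filter, Finset.mem_univ, true_and, IsJump, not_and]
        refine ⟨Fin.mk_le_mk.mpr (by omega), fun _ => (rankControl_eq_iff hP _ _).mp ?_⟩
        simpa [Nat.sub_add_cancel ha, Nat.sub_add_cancel hb] using hr
      · simp [Nat.sub_add_cancel ha, Nat.sub_add_cancel hb]
  have hS : Nat.card {p // IsJump P p} =
      (Finset.univ.filter fun p : Fin n × Fin n => p.1 ≤ p.2 ∧ IsJump P p).card := by
    rw [Nat.card_eq_fintype_card, Fintype.card_subtype]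
    congr 1
    ext p
    simp only [Finset.mem_filter, Finset.mem_univ, true_and]
    exact ⟨fun h => ⟨h.1, h⟩, fun h => h.2⟩
  have htri : ((Finset.univ.filter fun p : Fin n × Fin n => p.1 ≤ p.2).card : ℚ) =
      ((n : ℚ) ^ 2 + n) / 2 := by
    have h1 : (Finset.univ.filter fun p : Fin n × Fin n => p.1 ≤ p.2).card =
        ∑ j ∈ Finset.range n, (j + 1) := by
      rw [← Fin.sum_univ_eq_sum_range fun j => j + 1, Finset.card_filter,
        ← Finset.univ_product_univ, Finset.sum_product_right]
      refine Finset.sum_congr rfl fun j _ => ?_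
      rw [← Finset.card_filter]
      have : (Finset.univ.filter fun i : Fin n => i ≤ j) = Finset.Iic j := by ext; simp
      rw [this, Fin.card_Iic]
    rw [h1]
    clear hD hS h1 hP P
    induction n with
    | zero => simp
    | succ n ih =>
      rw [Finset.sum_range_succ, Nat.cast_add, ih]
      push_cast
      ring
  have hsum := Finset.card_filter_add_card_filter_not (s := Finset.univ.filter
    fun p : Fin n × Fin n => p.1 ≤ p.2) (IsJump P)
  rw [Finset.filter_filter, Finset.filter_filter, ← hD, ← hS] at hsum
  rw [← htri, ← hsum]
  push_cast
  ring

/-! ### The ideal of the orbit closure -/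

open MvPolynomial

/-- The upper-triangular matrix with entries `x (i, j)` for `i ≤ j`. -/
def upperTriangle {n : ℕ} {R : Type*} [Zero R] (x : Fin n × Fin n → R) :
    Matrix (Fin n) (Fin n) R :=
  Matrix.of fun i j => if i ≤ j then x (i, j) else 0

/-- The congruence transform of `P` by the upper-triangular matrix with entries `x`. -/
def congruenceTransform {n : ℕ} (P : Matrix (Fin n) (Fin n) ℂ) {R : Type*} [CommRing R]
    [Algebra ℂ R] (x : Fin n × Fin n → R) : Matrix (Fin n) (Fin n) R :=
  (upperTriangle x).transpose * P.map (algebraMap ℂ R) * upperTriangle x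

theorem map_congruenceTransform {n : ℕ} (P : Matrix (Fin n) (Fin n) ℂ) {R S : Type*} [CommRing R]
    [Algebra ℂ R] [CommRing S] [Algebra ℂ S] (φ : R →ₐ[ℂ] S) (x : Fin n × Fin n → R)
    (i j : Fin n) :
    φ (congruenceTransform P x i j) = congruenceTransform P (φ ∘ x) i j := by
  simp [congruenceTransform, upperTriangle, Matrix.mul_apply, apply_ite φ]

theorem isSymm_congruenceTransform {n : ℕ} {P : Matrix (Fin n) (Fin n) ℂ} (hP : P.IsSymm)
    {R : Type*} [CommRing R] [Algebra ℂ R] (x : Fin n × Fin n → R) :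
    (congruenceTransform P x).IsSymm := by
  rw [Matrix.IsSymm, congruenceTransform, Matrix.transpose_mul, Matrix.transpose_mul,
    Matrix.transpose_transpose, ← Matrix.transpose_map, hP.eq, Matrix.mul_assoc]

/-- The comorphism of the orbit map `B ↦ Bᵗ P B` on upper-triangular matrices. -/
noncomputable def orbitComorphism {n : ℕ} (P : Matrix (Fin n) (Fin n) ℂ) :
    MvPolynomial (Fin n × Fin n) ℂ →ₐ[ℂ] MvPolynomial (Fin n × Fin n) ℂ :=
  aeval fun p => congruenceTransform P X p.1 p.2

theorem aeval_orbitComorphism {n : ℕ} (P : Matrix (Fin n) (Fin n) ℂ) {R : Type*} [CommRing R]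
    [Algebra ℂ R] (x : Fin n × Fin n → R) (f : MvPolynomial (Fin n × Fin n) ℂ) :
    aeval x (orbitComorphism P f) = aeval (fun p => congruenceTransform P x p.1 p.2) f := by
  rw [orbitComorphism, ← AlgHom.comp_apply, comp_aeval]
  congr 2
  funext p
  rw [map_congruenceTransform]
  congr 1
  funext q
  simp

theorem det_upperTriangle {n : ℕ} {R : Type*} [CommRing R] (x : Fin n × Fin n → R) :
    (upperTriangle x).det = ∏ i, x (i, i) := by
  rw [Matrix.det_of_isUpperTriangular]
  · simp [upperTriangle]
  · intro i j hij
    exact if_neg (not_le.mpr hij)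

theorem upperTriangle_eq_self {n : ℕ} {R : Type*} [Zero R] {B : Matrix (Fin n) (Fin n) R}
    (hB : ∀ i j : Fin n, j < i → B i j = 0) : upperTriangle (fun p => B p.1 p.2) = B := by
  ext i j
  by_cases h : i ≤ j
  · simp [upperTriangle, h]
  · simp [upperTriangle, h, hB i j (not_le.mp h)]

theorem idealOf_congruenceOrbit {n : ℕ} (P : Matrix (Fin n) (Fin n) ℂ) :
    idealOf (congruenceOrbit P) = RingHom.ker (orbitComorphism P) := by
  have hmap : ∀ B : Matrix (Fin n) (Fin n) ℂ, B.map (algebraMap ℂ ℂ) = B := fun B => by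
    ext; simp
  ext f
  rw [idealOf, mem_vanishingIdeal_iff, RingHom.mem_ker, Set.forall_mem_image]
  constructor
  · intro h
    -- A polynomial vanishing at all points with nonzero coordinates is zero; `upperTriangle`
    -- discards the coordinates below the diagonal.
    refine funext_set (fun _ => {0}ᶜ) (fun _ => (Set.finite_singleton _).infinite_compl)
      fun x hx => ?_
    rw [map_zero, ← aeval_eq_eval, aeval_orbitComorphism]
    refine h ⟨upperTriangle x, ⟨?_, fun i j hij => if_neg (not_le.mpr hij)⟩, ?_⟩
    · rw [Matrix.isUnit_iff_isUnit_det, det_upperTriangle, isUnit_iff_ne_zero,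
        Finset.prod_ne_zero_iff]
      exact fun i _ => hx (i, i) trivial
    · rw [congruenceTransform, hmap]
  · rintro h A ⟨B, ⟨-, hB⟩, rfl⟩
    have := aeval_orbitComorphism P (fun p => B p.1 p.2) f
    rw [h, map_zero, congruenceTransform, upperTriangle_eq_self hB, hmap] at this
    exact this.symm

theorem idealOf_zariskiClosure {n : ℕ} (V : Set (Matrix (Fin n) (Fin n) ℂ)) :
    idealOf (zariskiClosure V) = idealOf V := by
  apply le_antisymm
  · refine vanishingIdeal_anti_mono (Set.image_mono fun A hA f hf => ?_)
    simpa [aeval_eq_eval] using hf _ ⟨A, hA, rfl⟩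
  · rintro f hf _ ⟨A, hA, rfl⟩
    simpa [aeval_eq_eval] using hA f hf

/-! ### Upper bound for the transcendence degree -/

open scoped IntermediateField.algebraAdjoinAdjoin in
theorem trdeg_adjoin_range_le {k K ι : Type} [Field k] [Field K] [Algebra k K] (g : ι → K) :
    Algebra.trdeg k (IntermediateField.adjoin k (Set.range g)) ≤ Cardinal.mk ι := by
  rw [← trdeg_add_eq k (Algebra.adjoin k (Set.range g)),
    trdeg_eq_zero (R := Algebra.adjoin k (Set.range g)), add_zero,
    Algebra.adjoin_range_eq_range_aeval]
  refine (trdeg_le_of_surjective _ (aeval (R := k) g).rangeRestrict_surjective).trans ?_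
  simp

/-- The coefficients `z` and `u` lie only in `K`. An `L`-linear retraction `π : K → L` moves `z`
into `L` while preserving the row relations among entries of `L`; the column relation then carries
the new row relation over to column `j`. No invertible minor has to be chosen. -/
theorem mem_of_row_combination_of_col_combination {k K : Type*} [Field k] [Field K] [Algebra k K]
    (L : IntermediateField k K) {n : ℕ} (M : Matrix (Fin n) (Fin n) K) (i j : Fin n)
    (hM : ∀ a b, a ≤ i → b ≤ j → (a, b) ≠ (i, j) → M a b ∈ L)
    (z u : Fin n → K) (hz : ∀ a, ¬a < i → z a = 0) (hu : ∀ b, ¬b < j → u b = 0)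
    (hrow : ∀ b ≤ j, M i b = ∑ a, z a * M a b) (hcol : ∀ a ≤ i, M a j = ∑ b, u b * M a b) :
    M i j ∈ L := by
  obtain ⟨π, hπ⟩ := LinearMap.exists_leftInverse_of_injective (Algebra.linearMap L K)
    (LinearMap.ker_eq_bot.mpr (algebraMap L K).injective)
  have hπL : ∀ x ∈ L, (π x : K) = x := fun x hx =>
    congrArg Subtype.val (LinearMap.congr_fun hπ ⟨x, hx⟩)
  have hπmul : ∀ x, ∀ y ∈ L, (π (x * y) : K) = π x * y := fun x y hy => by
    have h : x * y = (⟨y, hy⟩ : L) • x := mul_comm _ _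
    rw [h, map_smul, mul_comm]
    rfl
  have hrow' : ∀ b < j, M i b = ∑ a, (π (z a) : K) * M a b := by
    intro b hb
    rw [← hπL (M i b) (hM i b le_rfl hb.le fun h => hb.ne (congrArg Prod.snd h)), hrow b hb.le,
      map_sum, AddSubmonoidClass.coe_finsetSum]
    refine Finset.sum_congr rfl fun a _ => ?_
    by_cases ha : a < i
    · exact hπmul _ _ (hM a b ha.le hb.le fun h => ha.ne (congrArg Prod.fst h))
    · simp [hz a ha]
  have key : M i j = ∑ a, (π (z a) : K) * M a j := by
    calc M i j = ∑ b, u b * ∑ a, (π (z a) : K) * M a b := by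
          rw [hcol i le_rfl]
          refine Finset.sum_congr rfl fun b _ => ?_
          by_cases hb : b < j
          · rw [hrow' b hb]
          · simp [hu b hb]
      _ = ∑ a, (π (z a) : K) * ∑ b, u b * M a b := by
          simp_rw [Finset.mul_sum]
          rw [Finset.sum_comm]
          exact Finset.sum_congr rfl fun a _ => Finset.sum_congr rfl fun b _ => by ring
      _ = _ := by
          refine Finset.sum_congr rfl fun a _ => ?_
          by_cases ha : a < i
          · rw [hcol a ha.le]
          · simp [hz a ha]
  rw [key]
  refine sum_mem fun a _ => ?_
  by_cases ha : a < i
  · exact mul_mem (π (z a)).2 (hM a j ha.le le_rfl fun h => ha.ne (congrArg Prod.fst h))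
  · simp [hz a ha]

theorem exists_combination_of_previous_columns {n : ℕ} {K : Type*} [Field K]
    (B : Matrix (Fin n) (Fin n) K) (hB : B.IsUpperTriangular) (hdet : IsUnit B.det) (i : Fin n) :
    ∃ z : Fin n → K, (∀ a, ¬a < i → z a = 0) ∧ ∀ p < i, ∑ a, B p a * z a = B p i := by
  let v : Fin n → K := fun p => if p < i then B p i else 0
  have : Invertible B := Matrix.invertibleOfIsUnitDet B hdet
  have hinv := Matrix.blockTriangular_inv_of_blockTriangular hB
  refine ⟨B⁻¹.mulVec v, fun a ha => ?_, fun p hp => ?_⟩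
  · change ∑ p, B⁻¹ a p * v p = 0
    refine Finset.sum_eq_zero fun p _ => ?_
    by_cases hp : p < i
    · have h : B⁻¹ a p = 0 := hinv (hp.trans_le (not_lt.mp ha))
      rw [h, zero_mul]
    · simp [v, hp]
  · have h : B.mulVec (B⁻¹.mulVec v) = v := by
      rw [Matrix.mulVec_mulVec, Matrix.mul_nonsing_inv _ hdet, Matrix.one_mulVec]
    have := congrFun h p
    rwa [show v p = B p i from if_pos hp] at this

/-- With `z` expressing column `i` of `B` through earlier columns in the rows above `i`, the two
sides can differ only through row `i` of `PB`, which vanishes up to column `j`. -/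
theorem exists_row_combination_congruenceTransform {n : ℕ} (P : Matrix (Fin n) (Fin n) ℂ)
    {K : Type*} [Field K] [Algebra ℂ K] (x : Fin n × Fin n → K) (hx : ∀ i, x (i, i) ≠ 0)
    (i j : Fin n) (hP : ∀ q ≤ j, P i q = 0) :
    ∃ z : Fin n → K, (∀ a, ¬a < i → z a = 0) ∧
      ∀ b ≤ j, congruenceTransform P x i b = ∑ a, z a * congruenceTransform P x a b := by
  have hB : (upperTriangle x).IsUpperTriangular := fun i j hij => if_neg (not_le.mpr hij)
  have hdet : IsUnit (upperTriangle x).det := by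
    rw [det_upperTriangle, isUnit_iff_ne_zero, Finset.prod_ne_zero_iff]
    exact fun i _ => hx i
  obtain ⟨z, hz, hzB⟩ := exists_combination_of_previous_columns _ hB hdet i
  refine ⟨z, hz, fun b hb => ?_⟩
  set B := upperTriangle x with hBdef
  set N := P.map (algebraMap ℂ K) * B with hN
  have hM : ∀ a, congruenceTransform P x a b = ∑ p, B p a * N p b := fun a => by
    rw [congruenceTransform, Matrix.mul_assoc, ← hBdef, ← hN, Matrix.mul_apply]
    rfl
  have hNi : N i b = 0 := by
    rw [hN, Matrix.mul_apply]
    refine Finset.sum_eq_zero fun q _ => ?_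
    by_cases hq : q ≤ b
    · simp [hP q (hq.trans hb)]
    · rw [show B q b = 0 from hB (not_le.mp hq), mul_zero]
  calc congruenceTransform P x i b = ∑ p, (∑ a, B p a * z a) * N p b := by
        rw [hM]
        refine Finset.sum_congr rfl fun p _ => ?_
        rcases lt_trichotomy p i with hp | rfl | hp
        · rw [hzB p hp]
        · rw [hNi, mul_zero, mul_zero]
        · suffices h : ∑ a, B p a * z a = 0 by rw [show B p i = 0 from hB hp, h]
          refine Finset.sum_eq_zero fun a _ => ?_
          by_cases ha : a < i
          · rw [show B p a = 0 from hB (ha.trans hp), zero_mul]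
          · rw [hz a ha, mul_zero]
    _ = ∑ a, z a * congruenceTransform P x a b := by
        simp_rw [hM, Finset.mul_sum, Finset.sum_mul]
        rw [Finset.sum_comm]
        exact Finset.sum_congr rfl fun a _ => Finset.sum_congr rfl fun p _ => by ring

theorem congruenceTransform_mem_adjoin {n : ℕ} {P : Matrix (Fin n) (Fin n) ℂ}
    (hP : IsPartialInvolution P) {K : Type*} [Field K] [Algebra ℂ K] (x : Fin n × Fin n → K)
    (hx : ∀ i, x (i, i) ≠ 0) (i j : Fin n) :
    congruenceTransform P x i j ∈ IntermediateField.adjoin ℂ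
      (Set.range fun p : {p // IsJump P p} => congruenceTransform P x p.1.1 p.1.2) := by
  set L := IntermediateField.adjoin ℂ
    (Set.range fun p : {p // IsJump P p} => congruenceTransform P x p.1.1 p.1.2)
  have hsymm : ∀ a b, congruenceTransform P x a b = congruenceTransform P x b a :=
    fun a b => (isSymm_congruenceTransform hP.symm x).apply b a
  have hzero : ∀ a b, P a b ≠ 1 → P a b = 0 := fun a b => (hP.zero_or_one a b).resolve_right
  induction hm : (i : ℕ) + j using Nat.strong_induction_on generalizing i j with
  | _ m ih =>
  wlog hij : i ≤ j generalizing i j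
  · rw [hsymm]
    exact this j i (by omega) (le_of_not_ge hij)
  by_cases hjump : IsJump P (i, j)
  · exact IntermediateField.subset_adjoin _ _ ⟨⟨(i, j), hjump⟩, rfl⟩
  have hjump' : (∀ k ≤ j, P i k ≠ 1) ∧ ∀ k < i, P k j ≠ 1 := by
    simpa [IsJump, hij] using hjump
  obtain ⟨z, hz, hrow⟩ := exists_row_combination_congruenceTransform P x hx i j
    fun q hq => hzero _ _ (hjump'.1 q hq)
  -- By symmetry, column `j` is treated as row `j`, with `i` and `j` exchanged.
  obtain ⟨u, hu, hcol⟩ := exists_row_combination_congruenceTransform P x hx j i fun q hq => by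
    rw [← hP.symm.apply]
    rcases hq.lt_or_eq with h | rfl
    · exact hzero _ _ (hjump'.2 q h)
    · exact hzero _ _ (hjump'.1 j le_rfl)
  refine mem_of_row_combination_of_col_combination L (congruenceTransform P x) i j
    (fun a b ha hb hab => ih (a + b) ?_ a b rfl) z u hz hu hrow fun a ha => ?_
  · have : ¬((a : ℕ) = i ∧ (b : ℕ) = j) := fun h =>
      hab (Prod.ext (Fin.ext h.1) (Fin.ext h.2))
    simp only [Fin.le_def] at ha hb
    omega
  · rw [hsymm, hcol a ha]
    exact Finset.sum_congr rfl fun b _ => by rw [hsymm]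

theorem trdeg_quotient_ker_le {n : ℕ} {P : Matrix (Fin n) (Fin n) ℂ}
    (hP : IsPartialInvolution P) :
    Algebra.trdeg ℂ (MvPolynomial (Fin n × Fin n) ℂ ⧸ RingHom.ker (orbitComorphism P)) ≤
      Nat.card {p // IsJump P p} := by
  -- Over the fraction field the generic triangular matrix has nonzero diagonal, hence is
  -- invertible.
  let K := FractionRing (MvPolynomial (Fin n × Fin n) ℂ)
  let x : Fin n × Fin n → K := fun p => algebraMap (MvPolynomial (Fin n × Fin n) ℂ) K (X p)
  let L := IntermediateField.adjoin ℂ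
    (Set.range fun p : {p // IsJump P p} => congruenceTransform P x p.1.1 p.1.2)
  let ψ : MvPolynomial (Fin n × Fin n) ℂ →ₐ[ℂ] K :=
    (IsScalarTower.toAlgHom ℂ _ K).comp (orbitComorphism P)
  have hψ : ∀ p, ψ (X p) = congruenceTransform P x p.1 p.2 := fun p => by
    change IsScalarTower.toAlgHom ℂ _ K (orbitComorphism P (X p)) = _
    rw [orbitComorphism, aeval_X, map_congruenceTransform]
    rfl
  have hmem : ∀ f, ψ f ∈ L := fun f => by
    induction f using MvPolynomial.induction_on with
    | C a => exact (ψ.commutes a).symm ▸ L.algebraMap_mem a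
    | add f g hf hg => exact (map_add ψ f g).symm ▸ add_mem hf hg
    | mul_X f p hf =>
      rw [map_mul, hψ]
      refine mul_mem hf (congruenceTransform_mem_adjoin hP x (fun i => ?_) _ _)
      exact (map_ne_zero_iff _ (IsFractionRing.injective _ K)).mpr (X_ne_zero _)
  have hφ : ∀ a, (Ideal.kerLiftAlg (orbitComorphism P)) a ∈
      L.toSubalgebra.comap (IsScalarTower.toAlgHom ℂ _ K) := by
    intro a
    obtain ⟨f, rfl⟩ := Ideal.Quotient.mk_surjective a
    exact hmem f
  let φ : (MvPolynomial (Fin n × Fin n) ℂ ⧸ RingHom.ker (orbitComorphism P)) →ₐ[ℂ] L :=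
    AlgHom.codRestrict ((IsScalarTower.toAlgHom ℂ _ K).comp
      (Ideal.kerLiftAlg (orbitComorphism P))) L.toSubalgebra hφ
  have hinj : Function.Injective φ := by
    refine (AlgHom.injective_codRestrict _ _ _).mpr ?_
    exact (IsFractionRing.injective _ K).comp (Ideal.kerLiftAlg_injective _)
  refine ((trdeg_le_of_injective φ hinj).trans (trdeg_adjoin_range_le _)).trans_eq ?_
  rw [Nat.card, Cardinal.cast_toNat_of_lt_aleph0 (Cardinal.mk_lt_aleph0)]

/-! ### Lower bound for the transcendence degree -/

open Classical in
/-- The symmetric matrix whose entries at the jump positions are independent variables, and which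
is zero at the other positions. -/
noncomputable def jumpVariable {n : ℕ} (P : Matrix (Fin n) (Fin n) ℂ) (i j : Fin n) :
    MvPolynomial {p // IsJump P p} ℂ :=
  if h : IsJump P (min i j, max i j) then X ⟨_, h⟩ else 0

theorem jumpVariable_comm {n : ℕ} (P : Matrix (Fin n) (Fin n) ℂ) (i j : Fin n) :
    jumpVariable P i j = jumpVariable P j i := by
  unfold jumpVariable
  rw [min_comm, max_comm]

theorem jumpVariable_eq_X {n : ℕ} (P : Matrix (Fin n) (Fin n) ℂ) (p : {p // IsJump P p}) :
    jumpVariable P p.1.1 p.1.2 = X p := by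
  have h : (min p.1.1 p.1.2, max p.1.1 p.1.2) = p.1 := by
    rw [min_eq_left p.2.1, max_eq_right p.2.1]
  have h' : IsJump P (min p.1.1 p.1.2, max p.1.1 p.1.2) := by
    rw [h]
    exact p.2
  rw [jumpVariable, dif_pos h']
  exact congrArg X (Subtype.ext h)

theorem eval_one_jumpVariable {n : ℕ} {P : Matrix (Fin n) (Fin n) ℂ}
    (hP : IsPartialInvolution P) {i j : Fin n} (hij : P i j = 1) :
    aeval (fun _ => (1 : ℂ)) (jumpVariable P i j) = 1 := by
  wlog h : i ≤ j generalizing i j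
  · rw [jumpVariable_comm]
    exact this ((hP.symm.apply _ _).trans hij) (le_of_not_ge h)
  · rw [jumpVariable, dif_pos]
    · simp
    · rw [min_eq_left h, max_eq_right h]
      exact ⟨h, Or.inl ⟨j, le_rfl, hij⟩⟩

/-- The entries of an upper-triangular matrix transforming `P` into a matrix whose entries at the
jump positions determine the variables up to algebraic equations. -/
noncomputable def jumpPoint {n : ℕ} (P : Matrix (Fin n) (Fin n) ℂ) (p : Fin n × Fin n) :
    MvPolynomial {p // IsJump P p} ℂ :=
  ∑ r, C (P r p.1) * jumpVariable P r p.2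

-- Let `Y` be the matrix of jump variables. If `P p q = 1`, rows `p` and `q` of `PY` are rows `q`
-- and `p` of `Y`. This swap makes `Y i j` a factor of every term with `p = i` or `q = j`.
open Classical in
theorem congruenceTransform_jumpPoint {n : ℕ} {P : Matrix (Fin n) (Fin n) ℂ}
    (hP : IsPartialInvolution P) (i j : Fin n) :
    congruenceTransform P (jumpPoint P) i j = ∑ p, ∑ q,
      if p ≤ i ∧ q ≤ j ∧ P p q = 1 then jumpVariable P q i * jumpVariable P p j else 0 := by
  have hpt : ∀ r k l, P r k = 1 → jumpPoint P (k, l) = jumpVariable P r l := by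
    intro r k l h
    rw [jumpPoint, Finset.sum_eq_single r]
    · simp [h]
    · intro r' _ hr'
      rw [(hP.zero_or_one r' k).resolve_right fun h' => hr' (hP.col _ _ _ h' h)]
      simp
    · simp
  rw [congruenceTransform, Matrix.mul_assoc, Matrix.mul_apply]
  refine Finset.sum_congr rfl fun p _ => ?_
  rw [Matrix.mul_apply, Finset.mul_sum]
  refine Finset.sum_congr rfl fun q _ => ?_
  by_cases hpq : P p q = 1
  · have hqp : P q p = 1 := (hP.symm.apply _ _).trans hpq
    by_cases hp : p ≤ i <;> by_cases hq : q ≤ j <;>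
      simp [upperTriangle, hpq, hp, hq, hpt q p _ hqp, hpt p q _ hpq]
  · simp [(hP.zero_or_one p q).resolve_right hpq]

-- Induction on `i + j`: terms with `p ≠ i` and `q ≠ j` involve only earlier variables. The rest is
-- `Y i j ^ 2` if `P i j = 1`, and otherwise `α * Y i j` with `α ≠ 0` built from earlier variables.
open Classical in
theorem isAlgebraic_jumpVariable {n : ℕ} {P : Matrix (Fin n) (Fin n) ℂ}
    (hP : IsPartialInvolution P) (i j : Fin n) :
    IsAlgebraic (Algebra.adjoin ℂ (Set.range fun p : {p // IsJump P p} =>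
      congruenceTransform P (jumpPoint P) p.1.1 p.1.2)) (jumpVariable P i j) := by
  set T := Algebra.adjoin ℂ (Set.range fun p : {p // IsJump P p} =>
      congruenceTransform P (jumpPoint P) p.1.1 p.1.2)
  let F := Subalgebra.algebraicClosure T (MvPolynomial {p // IsJump P p} ℂ)
  change jumpVariable P i j ∈ F
  induction hm : (i : ℕ) + j using Nat.strong_induction_on generalizing i j with
  | _ m ih =>
  wlog hij : i ≤ j generalizing i j
  · rw [jumpVariable_comm]
    exact this j i (by omega) (le_of_not_ge hij)
  by_cases hjump : IsJump P (i, j)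
  swap
  · have : jumpVariable P i j = 0 := by
      rw [jumpVariable, dif_neg]
      rwa [min_eq_left hij, max_eq_right hij]
    exact this ▸ zero_mem F
  let t : Fin n → Fin n → MvPolynomial {p // IsJump P p} ℂ := fun p q =>
    if p ≤ i ∧ q ≤ j ∧ P p q = 1 then jumpVariable P q i * jumpVariable P p j else 0
  have hf : (∑ p, ∑ q, t p q) ∈ F := by
    rw [← congruenceTransform_jumpPoint hP]
    exact isAlgebraic_algebraMap
      (⟨_, Algebra.subset_adjoin ⟨⟨(i, j), hjump⟩, rfl⟩⟩ : T)
  have ht : ∀ p q, p ≠ i → q ≠ j → t p q ∈ F := by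
    intro p q hp hq
    simp only [t]
    split_ifs with h
    · exact mul_mem (ih (q + i) (by omega) q i rfl) (ih (p + j) (by omega) p j rfl)
    · exact zero_mem F
  have hsplit : ∑ p, ∑ q, t p q = (∑ q, t i q) + ((∑ p ∈ Finset.univ.erase i, t p j) +
      ∑ p ∈ Finset.univ.erase i, ∑ q ∈ Finset.univ.erase j, t p q) := by
    rw [← Finset.add_sum_erase _ _ (Finset.mem_univ i), ← Finset.sum_add_distrib]
    congr 1
    refine Finset.sum_congr rfl fun p _ => ?_
    rw [Finset.add_sum_erase _ _ (Finset.mem_univ j)]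
  have hlow : (∑ p ∈ Finset.univ.erase i, ∑ q ∈ Finset.univ.erase j, t p q) ∈ F :=
    sum_mem fun p hp => sum_mem fun q hq =>
      ht p q (Finset.ne_of_mem_erase hp) (Finset.ne_of_mem_erase hq)
  rw [hsplit, ← add_assoc] at hf
  have hmain := sub_mem hf hlow
  rw [add_sub_cancel_right] at hmain
  by_cases hPij : P i j = 1
  · have h1 : ∑ q, t i q = jumpVariable P i j ^ 2 := by
      rw [Finset.sum_eq_single j]
      · simp only [t, le_refl, hPij, and_self, if_true]
        rw [jumpVariable_comm P j i, sq]
      · intro q _ hq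
        exact if_neg fun h => hq (hP.row _ _ _ h.2.2 hPij)
      · simp
    have h2 : ∑ p ∈ Finset.univ.erase i, t p j = 0 := Finset.sum_eq_zero fun p hp =>
      if_neg fun h => Finset.ne_of_mem_erase hp (hP.col _ _ _ h.2.2 hPij)
    rw [h1, h2, add_zero] at hmain
    exact IsAlgebraic.of_pow two_pos hmain
  · let α : MvPolynomial {p // IsJump P p} ℂ :=
      (∑ q, if q ≤ j ∧ P i q = 1 then jumpVariable P q i else 0) +
        ∑ p, if p ≤ i ∧ P p j = 1 then jumpVariable P p j else 0
    have hα : (∑ q, t i q) + ∑ p ∈ Finset.univ.erase i, t p j = α * jumpVariable P i j := by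
      have h0 : t i j = 0 := if_neg fun h => hPij h.2.2
      rw [Finset.sum_erase (f := fun p => t p j) _ h0, add_mul, Finset.sum_mul, Finset.sum_mul]
      congr 1
      · refine Finset.sum_congr rfl fun q _ => ?_
        simp only [t, le_refl, true_and]
        rw [ite_mul, zero_mul]
      · refine Finset.sum_congr rfl fun p _ => ?_
        simp only [t, le_refl, true_and]
        rw [ite_mul, zero_mul, jumpVariable_comm P j i, mul_comm]
    have hαF : α ∈ F := by
      refine add_mem (sum_mem fun q _ => ?_) (sum_mem fun p _ => ?_)
      · split_ifs with h
        · have : q ≠ j := by rintro rfl; exact hPij h.2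
          exact ih (q + i) (by omega) q i rfl
        · exact zero_mem F
      · split_ifs with h
        · have : p ≠ i := by rintro rfl; exact hPij h.2
          exact ih (p + j) (by omega) p j rfl
        · exact zero_mem F
    -- Setting all variables to 1 turns `α` into the number of ones in the hook, positive at a jump.
    have hα0 : α ≠ 0 := by
      intro h
      have he : aeval (fun _ => (1 : ℂ)) α =
          (((Finset.univ.filter fun q => q ≤ j ∧ P i q = 1).card +
            (Finset.univ.filter fun p => p ≤ i ∧ P p j = 1).card : ℕ) : ℂ) := by
        rw [map_add, map_sum, map_sum, Finset.card_filter, Finset.card_filter]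
        push_cast
        congr 1
        · refine Finset.sum_congr rfl fun q _ => ?_
          split_ifs with h
          · exact eval_one_jumpVariable hP ((hP.symm.apply _ _).trans h.2)
          · exact map_zero _
        · refine Finset.sum_congr rfl fun p _ => ?_
          split_ifs with h
          · exact eval_one_jumpVariable hP h.2
          · exact map_zero _
      rw [h, map_zero, eq_comm, Nat.cast_eq_zero, Nat.add_eq_zero_iff, Finset.card_eq_zero,
        Finset.card_eq_zero, Finset.filter_eq_empty_iff, Finset.filter_eq_empty_iff] at he
      rcases hjump.2 with ⟨k, hk, hk1⟩ | ⟨k, hk, hk1⟩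
      · exact he.1 (Finset.mem_univ k) ⟨hk, hk1⟩
      · exact he.2 (Finset.mem_univ k) ⟨hk.le, hk1⟩
    rw [hα] at hmain
    exact IsAlgebraic.of_mul (mem_nonZeroDivisors_of_ne_zero hα0) hαF hmain

/-- A family with as many members as there are variables, over which the polynomial ring is
algebraic, is a transcendence basis. -/
theorem algebraicIndependent_congruenceTransform_jumpPoint {n : ℕ}
    {P : Matrix (Fin n) (Fin n) ℂ} (hP : IsPartialInvolution P) :
    AlgebraicIndependent ℂ fun p : {p // IsJump P p} =>
      congruenceTransform P (jumpPoint P) p.1.1 p.1.2 := by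
  set g := fun p : {p // IsJump P p} => congruenceTransform P (jumpPoint P) p.1.1 p.1.2 with hg
  have halg : Algebra.IsAlgebraic (Algebra.adjoin ℂ (Set.range g))
      (MvPolynomial {p // IsJump P p} ℂ) := by
    refine ⟨fun f => ?_⟩
    change f ∈ Subalgebra.algebraicClosure (Algebra.adjoin ℂ (Set.range g)) _
    induction f using MvPolynomial.induction_on with
    | C a =>
      exact isAlgebraic_algebraMap (algebraMap ℂ (Algebra.adjoin ℂ (Set.range g)) a)
    | add f g hf hg => exact add_mem hf hg
    | mul_X f p hf =>
      refine mul_mem hf ?_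
      rw [← jumpVariable_eq_X]
      exact isAlgebraic_jumpVariable hP _ _
  exact (Algebra.IsAlgebraic.isTranscendenceBasis_of_le_trdeg_of_finite ℂ g (by simp)).1

theorem le_trdeg_quotient_ker {n : ℕ} {P : Matrix (Fin n) (Fin n) ℂ}
    (hP : IsPartialInvolution P) : Nat.card {p // IsJump P p} ≤
    Algebra.trdeg ℂ (MvPolynomial (Fin n × Fin n) ℂ ⧸ RingHom.ker (orbitComorphism P)) := by
  -- Independence after a specialization implies independence before it. The special matrix may be
  -- singular, since the kernel already accounts for all triangular matrices.
  let ψ := (aeval (jumpPoint P)).comp (Ideal.kerLiftAlg (orbitComorphism P))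
  have h : AlgebraicIndependent ℂ fun p : {p // IsJump P p} =>
      Ideal.Quotient.mk (RingHom.ker (orbitComorphism P)) (X p.1) := by
    refine AlgebraicIndependent.of_comp ψ ?_
    convert algebraicIndependent_congruenceTransform_jumpPoint hP using 1
    funext p
    change aeval (jumpPoint P) (orbitComorphism P (X p.1)) = _
    rw [aeval_orbitComorphism, aeval_X]
  refine le_trans (Eq.le ?_) h.cardinalMk_le_trdeg
  rw [Nat.card, Cardinal.cast_toNat_of_lt_aleph0 (Cardinal.mk_lt_aleph0)]

end BorelCongruence

theorem theorem7p3 (n : ℕ) (P : Matrix (Fin n) (Fin n) ℂ)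
    (hP : BorelCongruence.IsPartialInvolution P) :
    ∃ d : ℕ,
      BorelCongruence.varietyDim
        (BorelCongruence.zariskiClosure (BorelCongruence.congruenceOrbit P)) = (d : WithBot ℕ∞) ∧
      (d : ℚ) = ((n : ℚ) ^ 2 + (n : ℚ)) / 2 - (BorelCongruence.diagonalEqualities P : ℚ) := by
  refine ⟨Nat.card {p // BorelCongruence.IsJump P p}, ?_, BorelCongruence.card_isJump hP⟩
  have : (RingHom.ker (BorelCongruence.orbitComorphism P)).IsPrime := RingHom.ker_isPrime _
  obtain ⟨s, hdim, htrdeg⟩ := BorelCongruence.exists_ringKrullDim_eq_and_trdeg_eq ℂ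
    (MvPolynomial (Fin n × Fin n) ℂ ⧸ RingHom.ker (BorelCongruence.orbitComorphism P))
  have hs := (BorelCongruence.trdeg_quotient_ker_le hP).antisymm
    (BorelCongruence.le_trdeg_quotient_ker hP)
  rw [htrdeg, Nat.cast_inj] at hs
  rw [BorelCongruence.varietyDim, BorelCongruence.idealOf_zariskiClosure,
    BorelCongruence.idealOf_congruenceOrbit, hdim, hs]
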